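/- Let $A$ be a unital (complex) $C^*$-algebra. For $y \in A$ let $\rho(y)$ denote the spectral radius of $y$. Call $A$ prime if $IJ \neq \{0\}$ for all nonzero two-sided ideals $I$ and $J$ of $A$. Then $A$ is prime if and only if, for all $a, b \in A$, the following two conditions are equivalent: (i) $\rho(ax) \leq \rho(bx)$ for all $x \in A$; (ii) $a = \lambda b$ for some $\lambda \in \mathbb{C}$ with $|\lambda| \leq 1$. -/

import Mathlib

/-- A ring `A` is prime if `I * J ≠ {0}` for all nonzero two-sided ideals `I` and `J` of `A`.
In a unital algebra the two-sided ring ideals are exactly the two-sided algebra ideals. -/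
def IsPrimeAlgebra (A : Type*) [Ring A] : Prop :=
  ∀ I J : Ideal A, I.IsTwoSided → J.IsTwoSided → I ≠ ⊥ → J ≠ ⊥ → I * J ≠ ⊥

section SpectralRadius

/-! If `A` is prime, cyclicity of ρ and the C*-identity turn (i) into `‖x * a * y‖ ≤ ‖x * b * y‖`.
Liouville's theorem applied to `exp(-t b z) a exp(t z b)` then gives `a z b = b z a`. Primeness
makes this proportionality: for `h = b* b` and `k` the real or imaginary part of `b* a`, each `k - t
h` has a definite sign, so connectedness of ℝ yields `k = t h`. Conversely, `I J = 0` with nonzero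
`u ∈ I`, `v ∈ J` makes `u`, `u + v` satisfy (i) without being proportional. -/

lemma spectralRadius_le_of_spectrum_diff_subset {A : Type*} [Ring A] [Algebra ℂ A] {s t : A}
    (h : spectrum ℂ s \ {0} ⊆ spectrum ℂ t) : spectralRadius ℂ s ≤ spectralRadius ℂ t := by
  refine iSup₂_le fun k hk ↦ ?_
  by_cases hk0 : k = 0
  · simp [hk0]
  · exact le_iSup₂_of_le (f := fun (k : ℂ) (_ : k ∈ spectrum ℂ t) ↦ (‖k‖₊ : ENNReal)) k
      (h ⟨hk, hk0⟩) le_rfl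

lemma spectralRadius_mul_comm {A : Type*} [Ring A] [Algebra ℂ A] (s t : A) :
    spectralRadius ℂ (s * t) = spectralRadius ℂ (t * s) := by
  apply le_antisymm <;> apply spectralRadius_le_of_spectrum_diff_subset <;>
    rw [spectrum.nonzero_mul_comm] <;> exact Set.sdiff_subset

/-- `k - s` and `k - t` commute, with product `k (k - (s + t))`. -/
lemma spectralRadius_le_add_of_mul_eq_zero {A : Type*} [Ring A] [Algebra ℂ A] {s t : A}
    (hst : s * t = 0) (hts : t * s = 0) : spectralRadius ℂ s ≤ spectralRadius ℂ (s + t) := by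
  refine spectralRadius_le_of_spectrum_diff_subset fun k ⟨hk, hk0⟩ ↦ ?_
  rw [spectrum.mem_iff] at hk ⊢
  refine fun hu ↦ hk ?_
  have hk0 : k ≠ 0 := hk0
  have e1 : (algebraMap ℂ A k - s) * (algebraMap ℂ A k - t) =
      algebraMap ℂ A k * (algebraMap ℂ A k - (s + t)) := by
    have := Algebra.commutes k s
    simp only [sub_mul, mul_sub, mul_add, hst, this]; abel
  have e2 : (algebraMap ℂ A k - t) * (algebraMap ℂ A k - s) =
      algebraMap ℂ A k * (algebraMap ℂ A k - (s + t)) := by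
    have := Algebra.commutes k t
    simp only [sub_mul, mul_sub, mul_add, hts, this]; abel
  have hku : IsUnit (algebraMap ℂ A k) := (IsUnit.mk0 k hk0).map _
  have hcomm : Commute (algebraMap ℂ A k - s) (algebraMap ℂ A k - t) := e1.trans e2.symm
  exact (hcomm.isUnit_mul_iff.1 (e1 ▸ hku.mul hu)).1

lemma spectralRadius_smul_le {A : Type*} [Ring A] [Algebra ℂ A] {c : ℂ} (hc : ‖c‖ ≤ 1) (s : A) :
    spectralRadius ℂ (c • s) ≤ spectralRadius ℂ s := by
  refine iSup₂_le fun k hk ↦ ?_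
  by_cases hc0 : c = 0
  · subst hc0
    rw [spectrum.mem_iff, zero_smul, sub_zero] at hk
    have : k = 0 := by
      by_contra hk0
      exact hk ((IsUnit.mk0 k hk0).map _)
    simp [this]
  · have hmem : c⁻¹ * k ∈ spectrum ℂ s := by
      rw [spectrum.mem_iff] at hk ⊢
      refine fun hu ↦ hk ?_
      have : algebraMap ℂ A k - c • s = algebraMap ℂ A c * (algebraMap ℂ A (c⁻¹ * k) - s) := by
        rw [mul_sub, ← map_mul, mul_inv_cancel_left₀ hc0, Algebra.smul_def]
      rw [this]
      exact ((IsUnit.mk0 c hc0).map _).mul hu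
    refine le_iSup₂_of_le (f := fun (k : ℂ) (_ : k ∈ spectrum ℂ s) ↦ (‖k‖₊ : ENNReal)) _ hmem ?_
    have : ‖k‖ ≤ ‖c⁻¹ * k‖ := by
      rw [norm_mul, norm_inv]
      exact le_mul_of_one_le_left (norm_nonneg _) ((one_le_inv₀ (norm_pos_iff.2 hc0)).2 hc)
    exact_mod_cast this

end SpectralRadius

section PrimeRing

variable {A : Type*} [Ring A]

lemma IsPrimeAlgebra.eq_zero_or_eq_zero (hA : IsPrimeAlgebra A) {u v : A}
    (huv : ∀ x, u * x * v = 0) : u = 0 ∨ v = 0 := by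
  let I : Ideal A :=
    { carrier := {z | ∀ x, z * x * v = 0}
      add_mem' := fun {p q} hp hq x ↦ by rw [add_mul, add_mul, hp, hq, add_zero]
      zero_mem' := fun x ↦ by simp
      smul_mem' := fun c p hp x ↦ by rw [smul_eq_mul, mul_assoc c, mul_assoc c, hp, mul_zero] }
  let J : Ideal A :=
    { carrier := {w | ∀ z ∈ I, ∀ x, z * x * w = 0}
      add_mem' := fun {p q} hp hq z hz x ↦ by rw [mul_add, hp z hz, hq z hz, add_zero]
      zero_mem' := fun z _ x ↦ by simp
      smul_mem' := fun c p hp z hz x ↦ by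
        rw [smul_eq_mul, ← mul_assoc, mul_assoc z, hp z hz] }
  have hI : I.IsTwoSided := ⟨fun {p} b hp x ↦ by rw [mul_assoc p]; exact hp _⟩
  have hJ : J.IsTwoSided := ⟨fun {p} b hp z hz x ↦ by rw [← mul_assoc, hp z hz, zero_mul]⟩
  by_contra! h
  refine hA I J hI hJ ?_ ?_ ?_
  · exact fun hb ↦ h.1 ((Submodule.mem_bot A).1 (hb ▸ (show u ∈ I from huv)))
  · exact fun hb ↦ h.2 ((Submodule.mem_bot A).1
      (hb ▸ (show v ∈ J from fun z (hz : ∀ x, z * x * v = 0) x ↦ hz x)))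
  · rw [eq_bot_iff, Ideal.mul_le]
    intro z hz w hw
    simpa using hw z hz 1

end PrimeRing

section CStar

variable {A : Type*} [CStarAlgebra A]

lemma CStarRing.eq_zero_of_forall_mul_mul_self_eq_zero {w : A} (h : ∀ x, w * x * w = 0) :
    w = 0 := by
  have h1 : star (w * star w) * (w * star w) = 0 := by
    rw [star_mul, star_star, ← mul_assoc, h, zero_mul]
  exact (CStarRing.mul_star_self_eq_zero_iff _).1 ((CStarRing.star_mul_self_eq_zero_iff _).1 h1)

lemma norm_mul_mul_le_of_spectralRadius_le {a b : A}
    (h : ∀ x, spectralRadius ℂ (a * x) ≤ spectralRadius ℂ (b * x)) (x y : A) :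
    ‖x * a * y‖ ≤ ‖x * b * y‖ := by
  nontriviality A
  -- The hypothesis is used at `y * star w * x`, so that cyclic permutation produces the
  -- self-adjoint `w * star w`.
  set w := x * a * y with hw
  have key : spectralRadius ℂ (w * star w) ≤ spectralRadius ℂ (x * b * y * star w) := by
    calc spectralRadius ℂ (w * star w) = spectralRadius ℂ (x * (a * (y * star w))) := by
          rw [hw]; simp only [mul_assoc]
      _ = spectralRadius ℂ (a * (y * star w * x)) := by
          rw [spectralRadius_mul_comm]; simp only [mul_assoc]
      _ ≤ spectralRadius ℂ (b * (y * star w * x)) := h _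
      _ = spectralRadius ℂ (x * (b * (y * star w))) := by
          rw [spectralRadius_mul_comm x]; simp only [mul_assoc]
      _ = _ := by simp only [mul_assoc]
  rw [(IsSelfAdjoint.mul_star_self w).spectralRadius_eq_nnnorm] at key
  have key2 := key.trans (spectrum.spectralRadius_le_nnnorm _)
  have key3 : ‖w * star w‖ ≤ ‖x * b * y * star w‖ := by exact_mod_cast key2
  rw [CStarRing.norm_self_mul_star] at key3
  have key4 := key3.trans (norm_mul_le _ _)
  rw [norm_star] at key4
  rcases (norm_nonneg w).eq_or_lt with h0 | h0
  · rw [← h0]; exact norm_nonneg _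
  · exact le_of_mul_le_mul_right key4 h0

lemma mul_mul_eq_of_norm_mul_mul_le {a b : A} (h : ∀ x y, ‖x * a * y‖ ≤ ‖x * b * y‖) (z : A) :
    a * z * b = b * z * a := by
  let E : A → ℂ → A := fun u t ↦ NormedSpace.exp (t • u)
  have hE : ∀ u t, HasDerivAt (E u) (E u t * u) t := fun u t ↦ hasDerivAt_exp_smul_const u t
  have hE0 : ∀ u, E u 0 = 1 := fun u ↦ by simp [E]
  have hEinv : ∀ u t, E (-u) t * E u t = 1 := fun u t ↦ by
    have : Commute (t • -u) (t • u) := by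
      rw [smul_neg]; exact (Commute.refl _).neg_left
    simp only [E]
    rw [← NormedSpace.exp_add_of_commute_of_mem_ball (𝕂 := ℂ) this]
    · simp
    · simp [NormedSpace.expSeries_radius_eq_top]
    · simp [NormedSpace.expSeries_radius_eq_top]
  let f : A → ℂ → A := fun c t ↦ E (-(b * z)) t * c * E (z * b) t
  have hf : ∀ c t, HasDerivAt (f c)
      (E (-(b * z)) t * -(b * z) * c * E (z * b) t +
        E (-(b * z)) t * c * (E (z * b) t * (z * b))) t :=
    fun c t ↦ ((hE _ t).mul_const c).mul (hE _ t)
  have hb : ∀ t, f b t = b := by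
    intro t
    have hconj : E (-(b * z)) t * b = b * E (-(z * b)) t := by
      have hsc : SemiconjBy b (t • -(z * b)) (t • -(b * z)) := by
        simp [SemiconjBy, mul_assoc]
      let _ : NormedAlgebra ℚ A := .restrictScalars ℚ ℂ A
      exact hsc.exp_right.symm
    simp only [f]
    rw [hconj, mul_assoc, hEinv, mul_one]
  have hconst : ∀ t, f a t = f a 0 := fun t ↦ by
    apply Differentiable.apply_eq_apply_of_bounded (fun t ↦ (hf a t).differentiableAt)
    rw [isBounded_iff_forall_norm_le]
    refine ⟨‖b‖, ?_⟩
    rintro _ ⟨t, rfl⟩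
    calc ‖f a t‖ ≤ ‖f b t‖ := h _ _
      _ = ‖b‖ := by rw [hb]
  -- The derivative at 0 of the constant `f a` is `a z b - b z a`.
  have hd := hf a 0
  rw [show f a = fun _ ↦ f a 0 from funext hconst] at hd
  have := (hasDerivAt_const (0 : ℂ) (f a 0)).unique hd
  simp only [hE0, one_mul, mul_one] at this
  rw [neg_mul, neg_add_eq_sub, eq_comm, sub_eq_zero] at this
  simpa [mul_assoc] using this

end CStar

section OrderedCStar

variable {A : Type*} [CStarAlgebra A] [PartialOrder A] [StarOrderedRing A]

/-- If the adjoint square of `m` is minus a product `u * q * v` with `q` and `v * u` positive, then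
`m = 0`, since such a product has nonnegative spectrum. -/
lemma eq_zero_of_star_mul_self_eq_neg {m u q v : A} (hq : 0 ≤ q) (hvu : 0 ≤ v * u)
    (h : star m * m = -(u * q * v)) : m = 0 := by
  have hsa : IsSelfAdjoint (u * q * v) := by
    rw [← neg_neg (u * q * v), ← h]
    exact (IsSelfAdjoint.star_mul_self m).neg
  have hr : 0 ≤ CFC.sqrt (v * u) := CFC.sqrt_nonneg _
  have hpos : 0 ≤ CFC.sqrt (v * u) * q * CFC.sqrt (v * u) := conjugate_nonneg_of_nonneg hq hr
  have hspec : spectrum ℝ (u * q * v) \ {0} =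
      spectrum ℝ (CFC.sqrt (v * u) * q * CFC.sqrt (v * u)) \ {0} := by
    rw [mul_assoc u, spectrum.nonzero_mul_comm, mul_assoc q, ← CFC.sqrt_mul_sqrt_self (v * u) hvu,
      ← mul_assoc q, spectrum.nonzero_mul_comm, mul_assoc, CFC.sqrt_mul_sqrt_self (v * u) hvu]
  have hnn : 0 ≤ u * q * v := by
    rw [StarOrderedRing.nonneg_iff_spectrum_nonneg (R := ℝ) _ hsa]
    intro k hk
    by_cases hk0 : k = 0
    · exact hk0.ge
    · exact spectrum_nonneg_of_nonneg hpos (hspec.subset ⟨hk, hk0⟩).1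
  rw [← CStarRing.star_mul_self_eq_zero_iff]
  refine le_antisymm ?_ (star_mul_self_nonneg m)
  rw [h]
  exact neg_nonpos.2 hnn

/-- Placing the identity between `p = c⁺` and `n = c⁻` introduces a minus sign, which positivity
turns into vanishing; primeness then removes a factor. -/
lemma IsPrimeAlgebra.nonneg_or_nonpos (hA : IsPrimeAlgebra A) {h c : A} (hh : 0 ≤ h)
    (hh0 : h ≠ 0) (hc : IsSelfAdjoint c) (hx : ∀ x, c * x * h = h * x * c) : 0 ≤ c ∨ c ≤ 0 := by
  have hch : Commute c h := (by simpa using hx 1 : c * h = h * c)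
  set p := c⁺ with hp
  set n := c⁻ with hn
  have hp0 : 0 ≤ p := CFC.posPart_nonneg c
  have hn0 : 0 ≤ n := CFC.negPart_nonneg c
  have hpn : p * n = 0 := CFC.posPart_mul_negPart c
  have hnp : n * p = 0 := CFC.negPart_mul_posPart c
  have hcpn : c = p - n := (CFC.posPart_sub_negPart c hc).symm
  have hph : Commute p h := by
    rw [hp, CFC.posPart_def]; exact hch.cfcₙ_real _
  have hnh : Commute n h := by
    rw [hn, CFC.negPart_def]; exact hch.cfcₙ_real _
  have hpc : p * c = p * p := by rw [hcpn, mul_sub, hpn, sub_zero]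
  have hcn : c * n = -(n * n) := by rw [hcpn, sub_mul, hpn, zero_sub]
  have key : ∀ x, p * p * x * (h * n) = -(h * p * x * (n * n)) := fun x ↦ by
    calc p * p * x * (h * n) = p * (c * x * h) * n := by rw [← hpc]; noncomm_ring
      _ = (p * h) * x * (c * n) := by rw [hx]; noncomm_ring
      _ = _ := by rw [hcn, hph.eq, mul_neg]
  have hph0 : 0 ≤ h * p := hph.symm.mul_nonneg hh hp0
  have hnh0 : 0 ≤ h * n := hnh.symm.mul_nonneg hh hn0
  have hpp0 : 0 ≤ p * p := (Commute.refl p).mul_nonneg hp0 hp0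
  have hnn0 : 0 ≤ n * n := (Commute.refl n).mul_nonneg hn0 hn0
  have hP : Commute (p * p) (h * p) :=
    (hph.mul_right (Commute.refl p)).mul_left (hph.mul_right (Commute.refl p))
  have hN : Commute (n * n) (h * n) :=
    (hnh.mul_right (Commute.refl n)).mul_left (hnh.mul_right (Commute.refl n))
  have hzero : ∀ x, p * p * x * (h * n) = 0 := fun x ↦ by
    refine eq_zero_of_star_mul_self_eq_neg (u := h * n) (q := star x * (p * p * (h * p)) * x)
      (v := n * n) (star_left_conjugate_nonneg (hP.mul_nonneg hpp0 hph0) x)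
      (hN.mul_nonneg hnn0 hnh0) ?_
    have hs : star (p * p * x * (h * n)) = h * n * star x * (p * p) := by
      rw [star_mul, (IsSelfAdjoint.of_nonneg hnh0).star_eq, star_mul,
        (IsSelfAdjoint.of_nonneg hpp0).star_eq, mul_assoc (h * n)]
    rw [hs, key]
    noncomm_ring
  have hsq : ∀ {y : A}, 0 ≤ y → y * y = 0 → y = 0 := fun {y} hy hyy ↦ by
    rw [← CStarRing.star_mul_self_eq_zero_iff, (IsSelfAdjoint.of_nonneg hy).star_eq, hyy]
  have hc1 : p = 0 → c ≤ 0 := fun h0 ↦ by rw [hcpn, h0, zero_sub]; exact neg_nonpos.2 hn0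
  have hc2 : n = 0 → 0 ≤ c := fun h0 ↦ by rw [hcpn, h0, sub_zero]; exact hp0
  rcases hA.eq_zero_or_eq_zero hzero with h1 | h1
  · exact Or.inr (hc1 (hsq hp0 h1))
  have hzero' : ∀ x, h * p * x * (n * n) = 0 := fun x ↦ by
    rw [← neg_eq_zero, ← key, hzero]
  rcases hA.eq_zero_or_eq_zero hzero' with h2 | h2
  -- Here `h` kills both parts of `c`, so primeness forces `c = 0`.
  · have hhc : h * c = 0 := by rw [hcpn, mul_sub, h1, h2, sub_zero]
    have hhxc : ∀ x, h * h * x * c = 0 := fun x ↦ by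
      calc h * h * x * c = h * (h * x * c) := by noncomm_ring
        _ = h * c * (x * h) := by rw [← hx]; noncomm_ring
        _ = 0 := by rw [hhc, zero_mul]
    rcases hA.eq_zero_or_eq_zero hhxc with h3 | h3
    · exact absurd (hsq hh h3) hh0
    · exact Or.inl h3.ge
  · exact Or.inl (hc2 (hsq hn0 h2))

lemma nonpos_of_forall_smul_le {h k : A} (H : ∀ t : ℝ, t • h ≤ k) : h ≤ 0 := by
  have hle : ∀ s : ℝ, 0 < s → h ≤ s • k := fun s hs ↦ by
    have := smul_le_smul_of_nonneg_left (H s⁻¹) hs.le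
    rwa [smul_smul, mul_inv_cancel₀ hs.ne', one_smul] at this
  have ht : Filter.Tendsto (fun s : ℝ ↦ s • k) (nhdsWithin 0 (Set.Ioi 0)) (nhds 0) := by
    have : Continuous fun s : ℝ ↦ s • k := by fun_prop
    simpa using (this.tendsto 0).mono_left nhdsWithin_le_nhds
  exact ge_of_tendsto ht (Filter.eventually_of_mem self_mem_nhdsWithin hle)

/-- The closed sets `t • h ≤ k` and `k ≤ t • h` cover ℝ and are nonempty, so they meet. -/
lemma IsPrimeAlgebra.exists_real_smul_eq (hA : IsPrimeAlgebra A) {h k : A} (hh : 0 ≤ h)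
    (hh0 : h ≠ 0) (hk : IsSelfAdjoint k) (hx : ∀ x, k * x * h = h * x * k) :
    ∃ t : ℝ, k = t • h := by
  have hdich : ∀ t : ℝ, t • h ≤ k ∨ k ≤ t • h := fun t ↦ by
    have := hA.nonneg_or_nonpos (c := k - t • h) hh hh0
      (hk.sub ((IsSelfAdjoint.all t).smul (IsSelfAdjoint.of_nonneg hh))) fun x ↦ by
        simp only [sub_mul, mul_sub, hx, smul_mul_assoc, mul_smul_comm]
    simpa only [sub_nonneg, sub_nonpos] using this
  have hS : IsClosed {t : ℝ | t • h ≤ k} := isClosed_le (by fun_prop) continuous_const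
  have hT : IsClosed {t : ℝ | k ≤ t • h} := isClosed_le continuous_const (by fun_prop)
  have hSne : ∃ t : ℝ, t • h ≤ k := by
    by_contra! hne
    refine hh0 (le_antisymm (nonpos_of_forall_smul_le (k := -k) fun t ↦ ?_) hh)
    have := (hdich (-t)).resolve_left (hne _)
    rw [neg_smul] at this
    exact le_neg_of_le_neg this
  have hTne : ∃ t : ℝ, k ≤ t • h := by
    by_contra! hne
    exact hh0 (le_antisymm
      (nonpos_of_forall_smul_le (k := k) fun t ↦ (hdich t).resolve_right (hne _)) hh)
  obtain ⟨t, -, ht1, ht2⟩ := isPreconnected_closed_iff.1 (isPreconnected_univ (α := ℝ)) _ _ hS hT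
    (fun t _ ↦ hdich t) (by simpa [Set.Nonempty] using hSne) (by simpa [Set.Nonempty] using hTne)
  exact ⟨t, le_antisymm ht2 ht1⟩

end OrderedCStar

section CStar

variable {A : Type*} [CStarAlgebra A]

lemma IsPrimeAlgebra.exists_smul_eq (hA : IsPrimeAlgebra A) {a b : A} (hb : b ≠ 0)
    (hab : ∀ x, a * x * b = b * x * a) : ∃ c : ℂ, a = c • b := by
  let _ := CStarAlgebra.spectralOrder A
  have := CStarAlgebra.spectralOrderedRing A
  set h := star b * b with hh
  set k := star b * a with hk
  have hh0 : 0 ≤ h := star_mul_self_nonneg b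
  have hne : h ≠ 0 := fun h0 ↦ hb ((CStarRing.star_mul_self_eq_zero_iff b).1 h0)
  have hsa : star h = h := IsSelfAdjoint.star_mul_self b
  have hkx : ∀ x, k * x * h = h * x * k := fun x ↦ by
    calc k * x * h = star b * (a * (x * star b) * b) := by rw [hk, hh]; noncomm_ring
      _ = _ := by rw [hab, hk, hh]; noncomm_ring
  have hkx' : ∀ x, star k * x * h = h * x * star k := fun x ↦ by
    have := congrArg star (hkx (star x))
    simp only [star_mul, star_star, hsa] at this
    simpa only [mul_assoc] using this.symm
  obtain ⟨s, hs⟩ := hA.exists_real_smul_eq hh0 hne (k := (realPart k : A)) (realPart k).2 fun x ↦ by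
    simp only [realPart_apply_coe, smul_mul_assoc, mul_smul_comm, add_mul, mul_add, hkx, hkx']
  obtain ⟨t, ht⟩ := hA.exists_real_smul_eq hh0 hne (k := (imaginaryPart k : A)) (imaginaryPart k).2 fun x ↦ by
    simp only [imaginaryPart_apply_coe, smul_mul_assoc, mul_smul_comm, sub_mul, mul_sub, hkx, hkx']
  let c : ℂ := s + Complex.I * t
  have hkc : k = c • h := by
    rw [← realPart_add_I_smul_imaginaryPart k, hs, ht, add_smul, mul_smul]
    simp
  refine ⟨c, ?_⟩
  have hd : star b * (a - c • b) = 0 := by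
    rw [mul_sub, mul_smul_comm, ← hk, ← hh, hkc, sub_self]
  -- `hab` moves `a - c • b` next to `star b`, which annihilates it.
  have hdx : ∀ x, h * x * (a - c • b) = 0 := fun x ↦ by
    calc h * x * (a - c • b) = star b * (b * x * a - c • (b * x * b)) := by
          rw [hh, mul_sub, mul_sub, mul_smul_comm, mul_smul_comm]; simp only [mul_assoc]
      _ = star b * (a - c • b) * (x * b) := by
          rw [← hab, mul_assoc (star b), sub_mul, smul_mul_assoc]; simp only [mul_assoc]
      _ = 0 := by rw [hd, zero_mul]
  exact sub_eq_zero.1 ((hA.eq_zero_or_eq_zero hdx).resolve_left hne)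

lemma IsPrimeAlgebra.exists_smul_eq_of_spectralRadius_le (hA : IsPrimeAlgebra A) {a b : A}
    (h : ∀ x, spectralRadius ℂ (a * x) ≤ spectralRadius ℂ (b * x)) :
    ∃ c : ℂ, ‖c‖ ≤ 1 ∧ a = c • b := by
  have hn := norm_mul_mul_le_of_spectralRadius_le h
  have hn1 : ‖a‖ ≤ ‖b‖ := by simpa using hn 1 1
  by_cases hb : b = 0
  · refine ⟨0, by simp, ?_⟩
    rw [hb, norm_zero] at hn1
    rw [zero_smul, norm_le_zero_iff.1 hn1]
  · obtain ⟨c, rfl⟩ := hA.exists_smul_eq hb (mul_mul_eq_of_norm_mul_mul_le hn)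
    refine ⟨c, ?_, rfl⟩
    rw [norm_smul] at hn1
    exact le_of_mul_le_mul_right (by simpa using hn1) (norm_pos_iff.2 hb)

lemma isPrimeAlgebra_of_forall_spectralRadius_le
    (H : ∀ a b : A, (∀ x, spectralRadius ℂ (a * x) ≤ spectralRadius ℂ (b * x)) →
      ∃ c : ℂ, a = c • b) : IsPrimeAlgebra A := by
  intro I J hI hJ hI0 hJ0 hIJ
  obtain ⟨u, huI, hu⟩ := Submodule.exists_mem_ne_zero_of_ne_bot hI0
  obtain ⟨v, hvJ, hv⟩ := Submodule.exists_mem_ne_zero_of_ne_bot hJ0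
  have huv : ∀ x, u * x * v = 0 := fun x ↦ by
    have : u * x * v ∈ I * J := Ideal.mul_mem_mul (I.mul_mem_right x huI) hvJ
    rwa [hIJ, Submodule.mem_bot] at this
  have hvu : ∀ x, v * x * u = 0 := fun x ↦
    CStarRing.eq_zero_of_forall_mul_mul_self_eq_zero fun y ↦ by
      calc v * x * u * y * (v * x * u) = v * x * (u * y * v) * (x * u) := by noncomm_ring
        _ = 0 := by rw [huv, mul_zero, zero_mul]
  obtain ⟨c, hc⟩ := H u (u + v) fun x ↦ by
    rw [add_mul]
    apply spectralRadius_le_add_of_mul_eq_zero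
    · rw [← mul_assoc, huv, zero_mul]
    · rw [← mul_assoc, hvu, zero_mul]
  have hcv : c • v = 0 := CStarRing.eq_zero_of_forall_mul_mul_self_eq_zero fun x ↦ by
    have : c • v = (1 - c) • u := by rw [sub_smul, one_smul, eq_sub_iff_add_eq, ← smul_add,
      add_comm v, ← hc]
    nth_rw 1 [this]
    rw [smul_mul_assoc, smul_mul_assoc, mul_smul_comm, huv, smul_zero, smul_zero]
  rcases smul_eq_zero.1 hcv with h0 | h0
  · exact hu (by rw [hc, h0, zero_smul])
  · exact hv h0

end CStar

theorem theorem3p7 (A : Type*) [CStarAlgebra A] :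
    IsPrimeAlgebra A ↔
      ∀ a b : A,
        (∀ x : A, spectralRadius ℂ (a * x) ≤ spectralRadius ℂ (b * x)) ↔
          ∃ c : ℂ, ‖c‖ ≤ 1 ∧ a = c • b := by
  refine ⟨fun hA a b ↦ ⟨hA.exists_smul_eq_of_spectralRadius_le, ?_⟩, fun H ↦ ?_⟩
  · rintro ⟨c, hc, rfl⟩ x
    rw [smul_mul_assoc]
    exact spectralRadius_smul_le hc _
  · exact isPrimeAlgebra_of_forall_spectralRadius_le fun a b hab ↦
      let ⟨c, _, hc⟩ := (H a b).1 hab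
      ⟨c, hc⟩
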